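/- Let $n\ge 0$ and $\gamma\ge 1$ be integers, write $[n]=\{1,\dots,n\}$, and let $u_0>0$ and $u_1\ge u_2\ge\cdots\ge u_n\ge 0$ be real numbers. For $x\in[0,1]^n$ put $$\phi(x)=\max_y\left\{\frac{\sum_{j\in[n]}u_jy_j}{\sum_{j\in[n]}u_jy_j+u_0}\;:\;\sum_{j\in[n]}y_j\le\gamma,\ y_j\le x_j,\ y_j\in[0,1]\ \ \forall j\in[n]\right\},$$ and let $\mathcal X=\{(w,x)\in\mathbb R\times\{0,1\}^n: w\le\phi(x)\}$. For disjoint $\mathcal S_0,\mathcal S_1\subseteq[n]$ let $\mathcal X(\mathcal S_0,\mathcal S_1)$ be the set of $(w,x)\in\mathcal X$ with $x_j=0$ for $j\in\mathcal S_0$ and $x_j=1$ for $j\in\mathcal S_1$. For $\mathcal S\subseteq[n]$ and $j\in[n]$ put, with $u(\mathcal S')=\sum_{j\in\mathcal S'}u_j$, $$\Phi(\mathcal S)=\max\left\{\frac{u(\mathcal S')}{u(\mathcal S')+u_0}:\mathcal S'\subseteq\mathcal S,\ |\mathcal S'|\le\gamma\right\},\qquad \rho_j(\mathcal S)=\Phi(\mathcal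 S\cup\{j\})-\Phi(\mathcal S).$$ An inequality $w\le c+\sum_{j}a_jx_j$ is facet-defining for $\operatorname{conv}(\mathcal X)$ if every point of $\operatorname{conv}(\mathcal X)$ satisfies it and the set of points of $\operatorname{conv}(\mathcal X)$ that satisfy it with equality is nonempty and has affine dimension $\dim\operatorname{conv}(\mathcal X)-1$. Let $\mathcal S\subseteq[n]$ and $s=|\mathcal S|$. Then the following hold. (1) For every ordering $j_1,\dots,j_s$ of $\mathcal S$, the down-lifted submodular inequality $$w\le\Phi(\mathcal S)+\sum_{j\in[n]\setminus\mathcal S}\rho_j(\mathcal S)x_j-\sum_{j\in\mathcal S}\eta_j(1-x_j)$$ is facet-defining for $\operatorname{conv}(\mathcal X)$, where the coefficients are defined successively for $\ell=1,\dots,s$ by $$\eta_{j_\ell}=\Phi(\mathcal S)-\sum_{\tau=1}^{\ell-1}\eta_{j_\tau}-\max\left\{w-\sum_{j\in[n]\setminus\mathcal S}\rho_j(\mathcal S)x_j-\sum_{\tau=1}^{\ell-1}\eta_{j_\tau}x_{j_\tau}:(w,x)\in\mathcal X(\{j_\ell\},\{j_{\ell+1},\dots,j_s\})\right\}.$$ (2)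 For every ordering $j_1,\dots,j_{n-s}$ of $[n]\setminus\mathcal S$, the up-lifted submodular inequality $$w\le\Phi(\mathcal S)-\sum_{j\in\mathcal S}\rho_j(\mathcal S\setminus\{j\})(1-x_j)+\sum_{j\in[n]\setminus\mathcal S}\zeta_jx_j$$ is facet-defining for $\operatorname{conv}(\mathcal X)$, where the coefficients are defined successively for $\ell=1,\dots,n-s$ by $$\zeta_{j_\ell}=-\Phi(\mathcal S)+\sum_{j\in\mathcal S}\rho_j(\mathcal S\setminus\{j\})+\max\left\{w-\sum_{j\in\mathcal S}\rho_j(\mathcal S\setminus\{j\})x_j-\sum_{\tau=1}^{\ell-1}\zeta_{j_\tau}x_{j_\tau}:(w,x)\in\mathcal X(\{j_{\ell+1},\dots,j_{n-s}\},\{j_\ell\})\right\}.$$ -/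

import Mathlib

namespace LiftedSubmodular

noncomputable section

variable {n : ℕ}

/-- The objective `∑ u_j y_j / (∑ u_j y_j + u₀)`. -/
def share (u₀ : ℝ) (u : Fin n → ℝ) (y : Fin n → ℝ) : ℝ :=
  (∑ j, u j * y j) / (∑ j, u j * y j + u₀)

/-- The feasible region of the maximization problem that defines `φ(x)`. -/
def allocations (γ : ℕ) (x : Fin n → ℝ) : Set (Fin n → ℝ) :=
  {y | ∑ j, y j ≤ (γ : ℝ) ∧ (∀ j, y j ≤ x j) ∧ ∀ j, y j ∈ Set.Icc (0 : ℝ) 1}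

/-- `φ(x)`, the maximum of `share` over the (fractional) allocations; it is attained, see
`exists_isGreatest_share`. -/
def phi (u₀ : ℝ) (u : Fin n → ℝ) (γ : ℕ) (x : Fin n → ℝ) : ℝ :=
  sSup (share u₀ u '' allocations γ x)

/-- `Φ(S) = max { u(S') / (u(S') + u₀) : S' ⊆ S, |S'| ≤ γ }`. -/
def Phi (u₀ : ℝ) (u : Fin n → ℝ) (γ : ℕ) (S : Finset (Fin n)) : ℝ :=
  (S.powerset.filter fun S' => S'.card ≤ γ).sup' ⟨∅, by simp⟩
    fun S' => (∑ j ∈ S', u j) / (∑ j ∈ S', u j + u₀)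

/-- The marginal gain `ρ_j(S) = Φ(S ∪ {j}) - Φ(S)`. -/
def rho (u₀ : ℝ) (u : Fin n → ℝ) (γ : ℕ) (j : Fin n) (S : Finset (Fin n)) : ℝ :=
  Phi u₀ u γ (insert j S) - Phi u₀ u γ S

/-- The mixed 0-1 set `X = {(w, x) ∈ ℝ × {0,1}ⁿ : w ≤ φ(x)}`. -/
def X (u₀ : ℝ) (u : Fin n → ℝ) (γ : ℕ) : Set (ℝ × (Fin n → ℝ)) :=
  {p | (∀ j, p.2 j = 0 ∨ p.2 j = 1) ∧ p.1 ≤ phi u₀ u γ p.2}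

/-- `X(S₀, S₁)`: the points of `X` with `x_j = 0` on `S₀` and `x_j = 1` on `S₁`. -/
def XRestr (u₀ : ℝ) (u : Fin n → ℝ) (γ : ℕ) (S₀ S₁ : Finset (Fin n)) :
    Set (ℝ × (Fin n → ℝ)) :=
  {p | p ∈ X u₀ u γ ∧ (∀ j ∈ S₀, p.2 j = 0) ∧ ∀ j ∈ S₁, p.2 j = 1}

/-- The optimal value `max {w - a(x) : (w, x) ∈ X(S₀, S₁)}` of a lifting problem; it is attained
whenever `S₀` and `S₁` are disjoint, see `isGreatest_liftMax`. -/
def liftMax (u₀ : ℝ) (u : Fin n → ℝ) (γ : ℕ) (S₀ S₁ : Finset (Fin n))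
    (a : (Fin n → ℝ) → ℝ) : ℝ :=
  sSup ((fun p : ℝ × (Fin n → ℝ) => p.1 - a p.2) '' XRestr u₀ u γ S₀ S₁)

/-- The down-lifting coefficients: for an ordering `σ` of `S`, the number `eta u₀ u γ S σ ℓ` is
the coefficient `η_{σ ℓ}`. -/
def eta (u₀ : ℝ) (u : Fin n → ℝ) (γ : ℕ) (S : Finset (Fin n)) (σ : Fin S.card ≃ S)
    (ℓ : Fin S.card) : ℝ :=
  Phi u₀ u γ S - ∑ τ : {τ // τ < ℓ}, eta u₀ u γ S σ τ.1
    - liftMax u₀ u γ {(σ ℓ : Fin n)} ((Finset.Ioi ℓ).image fun τ => (σ τ : Fin n))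
        (fun x => ∑ j ∈ Sᶜ, rho u₀ u γ j S * x j
          + ∑ τ : {τ // τ < ℓ}, eta u₀ u γ S σ τ.1 * x (σ τ.1))
termination_by ℓ.val
decreasing_by all_goals exact τ.2

/-- The up-lifting coefficients: for an ordering `σ` of the complement of `S`, the number
`zeta u₀ u γ S σ ℓ` is the coefficient `ζ_{σ ℓ}`. -/
def zeta (u₀ : ℝ) (u : Fin n → ℝ) (γ : ℕ) (S : Finset (Fin n))
    (σ : Fin Sᶜ.card ≃ (Sᶜ : Finset (Fin n))) (ℓ : Fin Sᶜ.card) : ℝ :=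
  - Phi u₀ u γ S + ∑ j ∈ S, rho u₀ u γ j (S.erase j)
    + liftMax u₀ u γ ((Finset.Ioi ℓ).image fun τ => (σ τ : Fin n)) {(σ ℓ : Fin n)}
        (fun x => ∑ j ∈ S, rho u₀ u γ j (S.erase j) * x j
          + ∑ τ : {τ // τ < ℓ}, zeta u₀ u γ S σ τ.1 * x (σ τ.1))
termination_by ℓ.val
decreasing_by all_goals exact τ.2

/-- Right-hand side of the down-lifted submodular inequality. -/
def downLiftedRhs (u₀ : ℝ) (u : Fin n → ℝ) (γ : ℕ) (S : Finset (Fin n)) (σ : Fin S.card ≃ S)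
    (x : Fin n → ℝ) : ℝ :=
  Phi u₀ u γ S + ∑ j ∈ Sᶜ, rho u₀ u γ j S * x j
    - ∑ ℓ, eta u₀ u γ S σ ℓ * (1 - x (σ ℓ))

/-- Right-hand side of the up-lifted submodular inequality. -/
def upLiftedRhs (u₀ : ℝ) (u : Fin n → ℝ) (γ : ℕ) (S : Finset (Fin n))
    (σ : Fin Sᶜ.card ≃ (Sᶜ : Finset (Fin n))) (x : Fin n → ℝ) : ℝ :=
  Phi u₀ u γ S - ∑ j ∈ S, rho u₀ u γ j (S.erase j) * (1 - x j)
    + ∑ ℓ, zeta u₀ u γ S σ ℓ * x (σ ℓ)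

/-- The inequality `w ≤ r(x)` (with `r` affine) defines a facet of the convex set `P`: it is valid
on `P`, and the face of the points of `P` that satisfy it with equality is nonempty and has
(affine) dimension `dim P - 1`. -/
def IsFacetDefining (P : Set (ℝ × (Fin n → ℝ))) (r : (Fin n → ℝ) → ℝ) : Prop :=
  (∀ p ∈ P, p.1 ≤ r p.2) ∧
  {p ∈ P | p.1 = r p.2}.Nonempty ∧
  Module.finrank ℝ (vectorSpan ℝ {p ∈ P | p.1 = r p.2}) + 1
    = Module.finrank ℝ (vectorSpan ℝ P)

/-- The maximum in the definition of `phi` is attained. -/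
theorem exists_isGreatest_share (u₀ : ℝ) (hu₀ : 0 < u₀) (u : Fin n → ℝ) (hu : ∀ j, 0 ≤ u j)
    (γ : ℕ) (x : Fin n → ℝ) (hx : ∀ j, 0 ≤ x j) :
    IsGreatest (share u₀ u '' allocations γ x) (phi u₀ u γ x) := by
  have hne : (allocations γ x).Nonempty := ⟨0, by simp, by simpa using hx, by simp⟩
  have hcl : IsClosed (allocations γ x) := by
    have h1 : IsClosed {y : Fin n → ℝ | ∑ j, y j ≤ (γ : ℝ)} :=
      isClosed_le (by fun_prop) (by fun_prop)
    have h2 : IsClosed {y : Fin n → ℝ | ∀ j, y j ≤ x j} := by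
      simp only [Set.ofPred_forall]
      exact isClosed_iInter fun j => isClosed_le (by fun_prop) (by fun_prop)
    have h3 : IsClosed {y : Fin n → ℝ | ∀ j, y j ∈ Set.Icc (0 : ℝ) 1} := by
      simp only [Set.ofPred_forall]
      exact isClosed_iInter fun j => isClosed_Icc.preimage (continuous_apply j)
    exact h1.inter (h2.inter h3)
  have hc : IsCompact (allocations γ x) :=
    (isCompact_Icc (a := (0 : Fin n → ℝ)) (b := 1)).of_isClosed_subset hcl
      fun y hy => ⟨fun j => (hy.2.2 j).1, fun j => (hy.2.2 j).2⟩
  have hcont : ContinuousOn (share u₀ u) (allocations γ x) := by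
    refine ContinuousOn.div (by fun_prop) (by fun_prop) fun y hy => ?_
    have : 0 ≤ ∑ j, u j * y j := Finset.sum_nonneg fun j _ => mul_nonneg (hu j) (hy.2.2 j).1
    positivity
  exact (hc.image_of_continuousOn hcont).isGreatest_sSup (hne.image _)

/-- The maximum of a lifting problem is attained. -/
theorem isGreatest_liftMax (u₀ : ℝ) (u : Fin n → ℝ) (γ : ℕ) (S₀ S₁ : Finset (Fin n))
    (hS : Disjoint S₀ S₁) (a : (Fin n → ℝ) → ℝ) :
    IsGreatest ((fun p : ℝ × (Fin n → ℝ) => p.1 - a p.2) '' XRestr u₀ u γ S₀ S₁)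
      (liftMax u₀ u γ S₀ S₁ a) := by
  let B : Set (Fin n → ℝ) := {x | (∀ j, x j = 0 ∨ x j = 1) ∧ (∀ j ∈ S₀, x j = 0) ∧
    ∀ j ∈ S₁, x j = 1}
  have hBf : B.Finite :=
    (Set.Finite.pi' (fun _ : Fin n => Set.toFinite ({0, 1} : Set ℝ))).subset
      fun x hx j => by simpa using hx.1 j
  have hBne : B.Nonempty := by
    refine ⟨fun j => if j ∈ S₁ then 1 else 0, fun j => ?_, fun j hj => ?_, fun j hj => ?_⟩
    · by_cases h : j ∈ S₁ <;> simp [h]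
    · simp [Finset.disjoint_left.mp hS hj]
    · simp [hj]
  obtain ⟨x, hx, hmax⟩ := hBf.exists_maximalFor (fun x => phi u₀ u γ x - a x) B hBne
  have hG : IsGreatest ((fun p : ℝ × (Fin n → ℝ) => p.1 - a p.2) '' XRestr u₀ u γ S₀ S₁)
      (phi u₀ u γ x - a x) := by
    refine ⟨⟨(phi u₀ u γ x, x), ⟨⟨hx.1, le_rfl⟩, hx.2.1, hx.2.2⟩, rfl⟩, ?_⟩
    rintro _ ⟨p, ⟨⟨h1, h2⟩, h3, h4⟩, rfl⟩
    have hp : p.2 ∈ B := ⟨h1, h3, h4⟩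
    have : phi u₀ u γ p.2 - a p.2 ≤ phi u₀ u γ x - a x := by
      rcases le_total (phi u₀ u γ x - a x) (phi u₀ u γ p.2 - a p.2) with h | h
      · exact hmax hp h
      · exact h
    simp only
    linarith
  rw [liftMax, hG.csSup_eq]
  exact hG

end

end LiftedSubmodular

/-!
Write `w ≤ r(x)` for either lifted inequality and `1_S` for the incidence vector of `S`.

On 0-1 points `φ` agrees with `Φ`, because the fractional knapsack problem with a cardinality
constraint has an integral optimum. `Φ` is submodular: it is the image of the weighted rank function
of a uniform matroid, which is monotone and submodular, under the increasing concave function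
`t ↦ t / (t + u₀)`. Submodularity makes `w ≤ r(x)` valid wherever `x` agrees with `1_S` on the
lifted coordinates, with equality at `1_S` and at its neighbours along the coordinates that are not
lifted.

Let `σ` be the lifting order. Every other 0-1 point lies in the stage `ℓ` of the lifting at which it
last differs from `1_S`, and the coefficient of `σ ℓ` is chosen so that `w ≤ r(x)` is valid and
attained there. The tight points collected in this way differ from `1_S` in a triangular pattern, so
they affinely span `ℝⁿ`, which makes the inequality facet-defining.
-/

namespace LiftedSubmodular

/-! ### Submodular set functions -/

section Submodular

variable {ι : Type*} [DecidableEq ι]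

/-- Submodularity of a real set function, in its lattice form. -/
def IsSubmodular (f : Finset ι → ℝ) : Prop :=
  ∀ A B, f (A ∪ B) + f (A ∩ B) ≤ f A + f B

theorem IsSubmodular.union_le {f : Finset ι → ℝ} (hf : IsSubmodular f) (S R : Finset ι) :
    f (S ∪ R) ≤ f S + ∑ j ∈ R, (f (insert j S) - f S) := by
  induction R using Finset.induction_on with
  | empty => simp
  | insert j R hj ih =>
    have hunion : (S ∪ R) ∪ insert j S = S ∪ insert j R := by grind
    have hinter : (S ∪ R) ∩ insert j S = S := by grind
    have hstep := hf (S ∪ R) (insert j S)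
    rw [hunion, hinter] at hstep
    rw [Finset.sum_insert hj]
    linarith

theorem IsSubmodular.sdiff_le {f : Finset ι → ℝ} (hf : IsSubmodular f) {S R : Finset ι}
    (hR : R ⊆ S) : f (S \ R) ≤ f S - ∑ j ∈ R, (f S - f (S.erase j)) := by
  induction R using Finset.induction_on with
  | empty => simp
  | insert j R hj ih =>
    have ih := ih ((Finset.subset_insert j R).trans hR)
    have hunion : (S \ R) ∪ S.erase j = S := by grind
    have hinter : (S \ R) ∩ S.erase j = S \ insert j R := by grind
    have hstep := hf (S \ R) (S.erase j)
    rw [hunion, hinter] at hstep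
    rw [Finset.sum_insert hj]
    linarith

theorem concaveOn_add_le_add {𝕜 : Type*} [Field 𝕜] [LinearOrder 𝕜] [IsStrictOrderedRing 𝕜]
    {s : Set 𝕜} {g : 𝕜 → 𝕜} (hg : ConcaveOn 𝕜 s g) {a b c d : 𝕜} (ha : a ∈ s) (hd : d ∈ s)
    (hab : a ≤ b) (hac : a ≤ c) (h : a + d = b + c) : g a + g d ≤ g b + g c := by
  obtain rfl | had := (show a ≤ d by linarith).eq_or_lt
  · obtain rfl : a = b := by linarith
    obtain rfl : a = c := by linarith
    rfl
  have hpos : 0 < d - a := sub_pos.2 had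
  obtain ⟨t, ht⟩ : ∃ t, t * (d - a) = b - a := ⟨(b - a) / (d - a), div_mul_cancel₀ _ hpos.ne'⟩
  have ht₀ : 0 ≤ t := nonneg_of_mul_nonneg_left (by linarith) hpos
  have ht₁ : 0 ≤ 1 - t := nonneg_of_mul_nonneg_left (b := d - a) (by linarith) hpos
  have hb : (1 - t) * g a + t * g d ≤ g b := by
    have hcomb : (1 - t) • a + t • d = b := by simp only [smul_eq_mul]; linarith
    exact hcomb ▸ hg.2 ha hd ht₁ ht₀ (by ring)
  have hc : t * g a + (1 - t) * g d ≤ g c := by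
    have hcomb : t • a + (1 - t) • d = c := by simp only [smul_eq_mul]; linarith
    exact hcomb ▸ hg.2 ha hd ht₀ ht₁ (by ring)
  linarith

theorem IsSubmodular.comp_concaveOn {f : Finset ι → ℝ} (hf : IsSubmodular f) (hmono : Monotone f)
    {g : ℝ → ℝ} {c : ℝ} (hg : ConcaveOn ℝ (Set.Ici c) g) (hgmono : MonotoneOn g (Set.Ici c))
    (hc : ∀ S, c ≤ f S) : IsSubmodular fun S => g (f S) := by
  intro A B
  have hA : f (A ∩ B) ≤ f A := hmono Finset.inter_subset_left
  have hB : f (A ∩ B) ≤ f B := hmono Finset.inter_subset_right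
  have hd : c ≤ f A + f B - f (A ∩ B) := by linarith [hc A]
  have hunion : g (f (A ∪ B)) ≤ g (f A + f B - f (A ∩ B)) :=
    hgmono (hc _) hd (by linarith [hf A B])
  have hconcave := concaveOn_add_le_add hg (hc _) hd hA hB (by ring)
  linarith

end Submodular

/-! ### Maximum weight of a set of bounded cardinality -/

section MaxWeight

variable {ι : Type*}

/-- The largest weight `∑ j ∈ Q, u j` of a set `Q ⊆ S` with at most `γ` elements. `Phi` is obtained
from it by applying `t ↦ t / (t + u₀)`. -/
noncomputable def maxWeight (u : ι → ℝ) (γ : ℕ) (S : Finset ι) : ℝ :=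
  (S.powerset.filter fun Q => Q.card ≤ γ).sup' ⟨∅, by simp⟩ fun Q => ∑ j ∈ Q, u j

variable {u : ι → ℝ} {γ : ℕ} {S : Finset ι}

theorem sum_le_maxWeight {Q : Finset ι} (hQ : Q ⊆ S) (hQγ : Q.card ≤ γ) :
    ∑ j ∈ Q, u j ≤ maxWeight u γ S :=
  Finset.le_sup' (fun Q => ∑ j ∈ Q, u j) (by simp [hQ, hQγ])

variable (u γ) in
theorem exists_maxWeight_eq_sum (S : Finset ι) :
    ∃ P ⊆ S, P.card ≤ γ ∧ maxWeight u γ S = ∑ j ∈ P, u j := by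
  obtain ⟨P, hP, hPmax⟩ := Finset.exists_mem_eq_sup' (s := S.powerset.filter fun Q => Q.card ≤ γ)
    ⟨∅, by simp⟩ fun Q => ∑ j ∈ Q, u j
  rw [Finset.mem_filter, Finset.mem_powerset] at hP
  exact ⟨P, hP.1, hP.2, hPmax⟩

theorem maxWeight_nonneg : 0 ≤ maxWeight u γ S := by
  simpa using sum_le_maxWeight (u := u) (γ := γ) (Finset.empty_subset S) (by simp)

theorem maxWeight_mono : Monotone (maxWeight u γ) := by
  intro S T hST
  obtain ⟨P, hP, hPγ, hPmax⟩ := exists_maxWeight_eq_sum u γ S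
  exact hPmax ▸ sum_le_maxWeight (hP.trans hST) hPγ

theorem exists_subset_card_eq_forall_le {α : Type*} [LinearOrder α] (v : ι → α) {T : Finset ι} :
    ∀ {k : ℕ}, k ≤ T.card → ∃ P ⊆ T, P.card = k ∧ ∀ i ∈ P, ∀ j ∈ T, j ∉ P → v j ≤ v i
  | 0, _ => ⟨∅, by simp⟩
  | k + 1, hk => by
    classical
    obtain ⟨P, hPT, rfl, htop⟩ := exists_subset_card_eq_forall_le v (Nat.le_of_succ_le hk)
    have hne : (T \ P).Nonempty := by
      rw [← Finset.card_pos, Finset.card_sdiff_of_subset hPT]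
      omega
    obtain ⟨m, hm, hmax⟩ := (T \ P).exists_max_image v hne
    exact ⟨insert m P, by grind, by grind, by grind⟩

theorem sum_mul_le_maxWeight {T : Finset ι} (hu : ∀ j ∈ T, 0 ≤ u j) {y : ι → ℝ}
    (hy₀ : ∀ j ∈ T, 0 ≤ y j) (hy₁ : ∀ j ∈ T, y j ≤ 1) (hyγ : ∑ j ∈ T, y j ≤ γ) :
    ∑ j ∈ T, u j * y j ≤ maxWeight u γ T := by
  obtain hT | hT := le_or_gt T.card γ
  · exact (Finset.sum_le_sum fun j hj => mul_le_of_le_one_right (hu j hj) (hy₁ j hj)).trans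
      (sum_le_maxWeight subset_rfl hT)
  classical
  obtain ⟨P, hPT, hPγ, htop⟩ := exists_subset_card_eq_forall_le u hT.le
  have hne : (T \ P).Nonempty := by
    rw [← Finset.card_pos, Finset.card_sdiff_of_subset hPT]
    omega
  obtain ⟨m, hm, hmax⟩ := (T \ P).exists_max_image u hne
  obtain ⟨hmT, hmP⟩ := Finset.mem_sdiff.1 hm
  -- `u m` is the optimal dual price of the cardinality constraint.
  have hin : ∑ j ∈ P, (u j - u m) * y j ≤ ∑ j ∈ P, (u j - u m) := Finset.sum_le_sum fun j hj =>
    mul_le_of_le_one_right (sub_nonneg.2 (htop j hj m hmT hmP)) (hy₁ j (hPT hj))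
  have hout : ∑ j ∈ T \ P, (u j - u m) * y j ≤ 0 := Finset.sum_nonpos fun j hj =>
    mul_nonpos_of_nonpos_of_nonneg (sub_nonpos.2 (hmax j hj)) (hy₀ j (Finset.sdiff_subset hj))
  calc ∑ j ∈ T, u j * y j
      = ∑ j ∈ T \ P, (u j - u m) * y j + ∑ j ∈ P, (u j - u m) * y j + u m * ∑ j ∈ T, y j := by
        rw [Finset.sum_sdiff hPT, Finset.mul_sum, ← Finset.sum_add_distrib]
        exact Finset.sum_congr rfl fun j _ => by ring
    _ ≤ 0 + ∑ j ∈ P, (u j - u m) + u m * γ := by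
        gcongr
        exact hu m hmT
    _ = ∑ j ∈ P, u j := by
        rw [Finset.sum_sub_distrib, Finset.sum_const, hPγ, nsmul_eq_mul]
        ring
    _ ≤ maxWeight u γ T := sum_le_maxWeight hPT hPγ.le

variable [DecidableEq ι]

theorem exists_balanced_exchange {A B P Q : Finset ι} (hP : P ⊆ A ∪ B) (hPγ : P.card ≤ γ)
    (hQ : Q ⊆ A ∩ B) (hQγ : Q.card ≤ γ) :
    ∃ P' ⊆ A, ∃ Q' ⊆ B, P'.card ≤ γ ∧ Q'.card ≤ γ ∧ P' ∪ Q' = P ∪ Q ∧ P' ∩ Q' = P ∩ Q := by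
  -- `P'` must contain `P \ B` and `P ∩ Q`, and may contain everything of `P ∪ Q` that lies in `A`.
  have hlower : (P \ B ∪ P ∩ Q).card ≤ P.card := Finset.card_le_card (by grind)
  have hupper : (P ∪ Q).card ≤ (P ∩ A ∪ Q).card + (P \ (A ∪ Q)).card :=
    (Finset.card_le_card (by grind)).trans (Finset.card_union_le _ _)
  have hrest : (P \ (A ∪ Q)).card + (P ∩ Q).card ≤ P.card := by
    rw [← Finset.card_union_of_disjoint (Finset.disjoint_left.2 (by grind))]
    exact Finset.card_le_card (by grind)
  have hsub : P \ B ∪ P ∩ Q ⊆ P ∩ A ∪ Q := by grind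
  have hcard := Finset.card_union_add_card_inter P Q
  obtain ⟨P', hlowP', hP'up, hP'card⟩ := Finset.exists_subsuperset_card_eq hsub
    (n := max (P \ B ∪ P ∩ Q).card (P.card + Q.card - γ)) (le_max_left _ _)
    (max_le (Finset.card_le_card hsub) (by omega))
  have hunion : P' ∪ ((P ∪ Q) \ P' ∪ P ∩ Q) = P ∪ Q := by grind
  have hinter : P' ∩ ((P ∪ Q) \ P' ∪ P ∩ Q) = P ∩ Q := by grind
  have hcard' := Finset.card_union_add_card_inter P' ((P ∪ Q) \ P' ∪ P ∩ Q)
  rw [hunion, hinter] at hcard'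
  exact ⟨P', by grind, (P ∪ Q) \ P' ∪ P ∩ Q, by grind, by omega, by omega, hunion, hinter⟩

theorem isSubmodular_maxWeight : IsSubmodular (maxWeight u γ) := by
  intro A B
  obtain ⟨P, hP, hPγ, hPmax⟩ := exists_maxWeight_eq_sum u γ (A ∪ B)
  obtain ⟨Q, hQ, hQγ, hQmax⟩ := exists_maxWeight_eq_sum u γ (A ∩ B)
  obtain ⟨P', hP', Q', hQ', hP'γ, hQ'γ, hunion, hinter⟩ := exists_balanced_exchange hP hPγ hQ hQγ
  calc maxWeight u γ (A ∪ B) + maxWeight u γ (A ∩ B)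
      = ∑ j ∈ P, u j + ∑ j ∈ Q, u j := by rw [hPmax, hQmax]
    _ = ∑ j ∈ P', u j + ∑ j ∈ Q', u j := by
        rw [← Finset.sum_union_inter, ← hunion, ← hinter, Finset.sum_union_inter]
    _ ≤ maxWeight u γ A + maxWeight u γ B :=
        add_le_add (sum_le_maxWeight hP' hP'γ) (sum_le_maxWeight hQ' hQ'γ)

end MaxWeight

/-! ### Incidence vectors -/

section Incidence

variable {ι : Type*} [DecidableEq ι]

/-- The incidence vector of `T`, through which the 0-1 points are identified with finite sets. -/
noncomputable def incidence (T : Finset ι) : ι → ℝ := fun j => if j ∈ T then 1 else 0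

theorem incidence_eq_incidence_iff {S T : Finset ι} {j : ι} :
    incidence T j = incidence S j ↔ (j ∈ T ↔ j ∈ S) := by
  by_cases hT : j ∈ T <;> by_cases hS : j ∈ S <;> simp [incidence, hT, hS]

theorem incidence_mem_Icc (T : Finset ι) (j : ι) : incidence T j ∈ Set.Icc (0 : ℝ) 1 := by
  by_cases h : j ∈ T <;> simp [incidence, h]

theorem sum_mul_incidence (a : ι → ℝ) (R T : Finset ι) :
    ∑ j ∈ R, a j * incidence T j = ∑ j ∈ R ∩ T, a j := by
  simp [incidence, Finset.sum_ite_mem]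

theorem forall_eq_zero_or_one_iff_exists_incidence [Finite ι] {x : ι → ℝ} :
    (∀ j, x j = 0 ∨ x j = 1) ↔ ∃ T : Finset ι, x = incidence T := by
  have := Fintype.ofFinite ι
  constructor
  · intro hx
    refine ⟨Finset.univ.filter fun j => x j = 1, funext fun j => ?_⟩
    obtain h | h := hx j <;> simp [incidence, h]
  · rintro ⟨T, rfl⟩ j
    by_cases h : j ∈ T <;> simp [incidence, h]

end Incidence

/-! ### The functions `Phi` and `phi` -/

section Phi

variable {n : ℕ} {u₀ : ℝ} {u : Fin n → ℝ}

theorem monotoneOn_div_add (hu₀ : 0 < u₀) : MonotoneOn (fun t => t / (t + u₀)) (Set.Ici 0) := by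
  intro a (ha : 0 ≤ a) b _ hab
  have hb : 0 ≤ b := ha.trans hab
  change a / (a + u₀) ≤ b / (b + u₀)
  rw [div_le_div_iff₀ (by positivity) (by positivity)]
  linarith [mul_le_mul_of_nonneg_right hab hu₀.le]

theorem concaveOn_div_add (hu₀ : 0 < u₀) : ConcaveOn ℝ (Set.Ici 0) fun t => t / (t + u₀) := by
  have hslope : ∀ a b : ℝ, 0 ≤ a → a < b →
      (b / (b + u₀) - a / (a + u₀)) / (b - a) = u₀ / ((a + u₀) * (b + u₀)) := by
    intro a b ha hab
    have hb : 0 < b := ha.trans_lt hab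
    have hsub : b - a ≠ 0 := (sub_pos.2 hab).ne'
    field_simp
    ring
  refine concaveOn_of_slope_anti_adjacent (convex_Ici 0) fun {a b c} ha _ hab hbc => ?_
  have ha : 0 ≤ a := ha
  have hb : 0 ≤ b := ha.trans hab.le
  have : 0 ≤ c := hb.trans hbc.le
  rw [hslope a b ha hab, hslope b c hb hbc, mul_comm (a + u₀)]
  gcongr
  exact hab.le.trans hbc.le

theorem Phi_eq_maxWeight_div (hu₀ : 0 < u₀) (hu : ∀ j, 0 ≤ u j) (γ : ℕ) (S : Finset (Fin n)) :
    Phi u₀ u γ S = maxWeight u γ S / (maxWeight u γ S + u₀) := by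
  apply le_antisymm
  · refine Finset.sup'_le _ _ fun Q hQ => ?_
    rw [Finset.mem_filter, Finset.mem_powerset] at hQ
    exact monotoneOn_div_add hu₀ (Finset.sum_nonneg fun j _ => hu j) maxWeight_nonneg
      (sum_le_maxWeight hQ.1 hQ.2)
  · obtain ⟨P, hP, hPγ, hPmax⟩ := exists_maxWeight_eq_sum u γ S
    rw [hPmax]
    exact Finset.le_sup' (fun Q => (∑ j ∈ Q, u j) / (∑ j ∈ Q, u j + u₀)) (by simp [hP, hPγ])

theorem isSubmodular_Phi (hu₀ : 0 < u₀) (hu : ∀ j, 0 ≤ u j) (γ : ℕ) :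
    IsSubmodular (Phi u₀ u γ) := by
  rw [funext (Phi_eq_maxWeight_div hu₀ hu γ)]
  exact isSubmodular_maxWeight.comp_concaveOn maxWeight_mono (concaveOn_div_add hu₀)
    (monotoneOn_div_add hu₀) fun _ => maxWeight_nonneg

theorem sum_mul_le_maxWeight_of_mem_allocations (hu : ∀ j, 0 ≤ u j) {γ : ℕ} {T : Finset (Fin n)}
    {y : Fin n → ℝ} (hy : y ∈ allocations γ (incidence T)) :
    ∑ j, u j * y j ≤ maxWeight u γ T := by
  obtain ⟨hyγ, hyT, hy⟩ := hy
  have hzero : ∀ j ∉ T, y j = 0 := fun j hj =>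
    le_antisymm (by simpa [incidence, hj] using hyT j) (hy j).1
  rw [← Finset.sum_subset T.subset_univ fun j _ hj => hzero j hj] at hyγ
  rw [← Finset.sum_subset T.subset_univ fun j _ hj => by rw [hzero j hj, mul_zero]]
  exact sum_mul_le_maxWeight (fun j _ => hu j) (fun j _ => (hy j).1) (fun j _ => (hy j).2) hyγ

theorem incidence_mem_allocations {γ : ℕ} {P T : Finset (Fin n)} (hPT : P ⊆ T)
    (hP : P.card ≤ γ) : incidence P ∈ allocations γ (incidence T) := by
  refine ⟨?_, fun j => ?_, incidence_mem_Icc P⟩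
  · simpa [incidence] using hP
  · by_cases hj : j ∈ P
    · simp [incidence, hj, hPT hj]
    · simpa [incidence, hj] using (incidence_mem_Icc T j).1

theorem phi_incidence (hu₀ : 0 < u₀) (hu : ∀ j, 0 ≤ u j) (γ : ℕ) (T : Finset (Fin n)) :
    phi u₀ u γ (incidence T) = Phi u₀ u γ T := by
  have hphi := exists_isGreatest_share u₀ hu₀ u hu γ (incidence T) fun j =>
    (incidence_mem_Icc T j).1
  rw [Phi_eq_maxWeight_div hu₀ hu]
  apply le_antisymm
  · obtain ⟨y, hy, hyphi⟩ := hphi.1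
    rw [← hyphi]
    exact monotoneOn_div_add hu₀ (Finset.sum_nonneg fun j _ => mul_nonneg (hu j) (hy.2.2 j).1)
      maxWeight_nonneg (sum_mul_le_maxWeight_of_mem_allocations hu hy)
  · obtain ⟨P, hPT, hPγ, hPmax⟩ := exists_maxWeight_eq_sum u γ T
    refine hphi.2 ⟨incidence P, incidence_mem_allocations hPT hPγ, ?_⟩
    rw [hPmax, share, sum_mul_incidence, Finset.univ_inter]

theorem mem_X_iff (hu₀ : 0 < u₀) (hu : ∀ j, 0 ≤ u j) {γ : ℕ} {p : ℝ × (Fin n → ℝ)} :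
    p ∈ X u₀ u γ ↔ ∃ T, p.2 = incidence T ∧ p.1 ≤ Phi u₀ u γ T := by
  constructor
  · rintro ⟨h01, hle⟩
    obtain ⟨T, hT⟩ := forall_eq_zero_or_one_iff_exists_incidence.1 h01
    exact ⟨T, hT, by rwa [hT, phi_incidence hu₀ hu] at hle⟩
  · rintro ⟨T, hT, hle⟩
    exact ⟨forall_eq_zero_or_one_iff_exists_incidence.2 ⟨T, hT⟩, by
      rwa [hT, phi_incidence hu₀ hu]⟩

end Phi

/-! ### A criterion for facets -/

section Facet

theorem eq_top_of_triangular {ι K α : Type*} [Finite ι] [DivisionRing K]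
    [Preorder α] [WellFoundedLT α] {W : Submodule K (ι → K)} (rank : ι → α)
    (h : ∀ i, ∃ d ∈ W, d i ≠ 0 ∧ ∀ j ≠ i, d j ≠ 0 → rank j < rank i) : W = ⊤ := by
  classical
  have := Fintype.ofFinite ι
  have hsingle : ∀ a i, rank i = a → Pi.single i (1 : K) ∈ W := by
    intro a
    induction a using WellFoundedLT.induction with
    | _ a ih =>
      rintro i rfl
      obtain ⟨d, hd, hdi, hlt⟩ := h i
      have hrest : ∑ j ∈ Finset.univ.erase i, d j • Pi.single j (1 : K) ∈ W := by
        refine W.sum_mem fun j hj => ?_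
        by_cases hdj : d j = 0
        · simp [hdj]
        · exact W.smul_mem _ (ih _ (hlt j (Finset.ne_of_mem_erase hj) hdj) j rfl)
      have hsplit : d - ∑ j ∈ Finset.univ.erase i, d j • Pi.single j (1 : K)
          = d i • Pi.single i (1 : K) := by
        rw [sub_eq_iff_eq_add, Finset.add_sum_erase _ (fun j => d j • Pi.single j (1 : K))
          (Finset.mem_univ i)]
        exact pi_eq_sum_univ' d
      exact (W.smul_mem_iff hdi).1 (hsplit ▸ W.sub_mem hd hrest)
  refine eq_top_iff.2 fun x _ => ?_
  rw [pi_eq_sum_univ' x]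
  exact W.sum_mem fun j _ => W.smul_mem _ (hsingle _ j rfl)

variable {E : Type*} [AddCommGroup E] [Module ℝ E]

/-- The linear functional `(w, x) ↦ w - A.linear x`, whose kernel is the direction of the hyperplane
`w = A x`. -/
def slack (A : E →ᵃ[ℝ] ℝ) : Module.Dual ℝ (ℝ × E) :=
  LinearMap.fst ℝ ℝ E - A.linear ∘ₗ LinearMap.snd ℝ ℝ E

theorem slack_sub (A : E →ᵃ[ℝ] ℝ) (p q : ℝ × E) :
    slack A (p - q) = (p.1 - A p.2) - (q.1 - A q.2) := by
  have h := A.linearMap_vsub p.2 q.2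
  simp only [vsub_eq_sub] at h
  simp only [slack, LinearMap.sub_apply, LinearMap.fst_apply, LinearMap.comp_apply,
    LinearMap.snd_apply, Prod.fst_sub, Prod.snd_sub, h]
  ring

theorem vectorSpan_eq_ker_slack (A : E →ᵃ[ℝ] ℝ) {F : Set (ℝ × E)} (hF : ∀ p ∈ F, p.1 = A p.2)
    (hspan : vectorSpan ℝ (Prod.snd '' F) = ⊤) : vectorSpan ℝ F = LinearMap.ker (slack A) := by
  have hle : vectorSpan ℝ F ≤ LinearMap.ker (slack A) := by
    rw [vectorSpan_def, Submodule.span_le]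
    rintro _ ⟨p, hp, q, hq, rfl⟩
    simp [slack_sub, hF p hp, hF q hq]
  refine hle.antisymm fun z hz => ?_
  have hmap : (vectorSpan ℝ F).map (LinearMap.snd ℝ ℝ E) = ⊤ := by
    rw [← hspan]
    exact (LinearMap.snd ℝ ℝ E).toAffineMap.map_vectorSpan
  obtain ⟨z', hz', hsnd⟩ : z.2 ∈ (vectorSpan ℝ F).map (LinearMap.snd ℝ ℝ E) := hmap ▸ trivial
  have hzz' : z.1 = z'.1 := by
    have hz₀ : z.1 - A.linear z.2 = 0 := hz
    have hz'₀ : z'.1 - A.linear z'.2 = 0 := hle hz'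
    rw [show z'.2 = z.2 from hsnd] at hz'₀
    linarith
  rwa [show z = z' from Prod.ext hzz' hsnd.symm]

theorem convex_affine_hypograph (A : E →ᵃ[ℝ] ℝ) : Convex ℝ {p : ℝ × E | p.1 ≤ A p.2} := by
  intro p hp q hq a b ha hb hab
  change a * p.1 + b * q.1 ≤ A (a • p.2 + b • q.2)
  rw [Convex.combo_affine_apply hab]
  exact add_le_add (mul_le_mul_of_nonneg_left hp ha) (mul_le_mul_of_nonneg_left hq hb)

/-- The points `x` above which the inequality `w ≤ r(x)` is attained with equality in `Q`. -/
def tightPoints (Q : Set (ℝ × E)) (r : E → ℝ) : Set E :=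
  {x | (r x, x) ∈ Q}

variable {n : ℕ} {Q : Set (ℝ × (Fin n → ℝ))}

theorem isFacetDefining_convexHull_of_vectorSpan_eq_top (A : (Fin n → ℝ) →ᵃ[ℝ] ℝ)
    (hvalid : ∀ p ∈ Q, p.1 ≤ A p.2) (hslack : ∃ p ∈ Q, p.1 < A p.2)
    (hne : (tightPoints Q A).Nonempty) (hspan : vectorSpan ℝ (tightPoints Q A) = ⊤) :
    IsFacetDefining (convexHull ℝ Q) A := by
  set F := {p ∈ convexHull ℝ Q | p.1 = A p.2} with hF
  have htight : tightPoints Q A ⊆ Prod.snd '' F := fun x hx =>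
    ⟨(A x, x), ⟨subset_convexHull ℝ Q hx, rfl⟩, rfl⟩
  have hker : vectorSpan ℝ F = LinearMap.ker (slack A) :=
    vectorSpan_eq_ker_slack A (fun p hp => hp.2)
      (top_le_iff.1 (hspan ▸ vectorSpan_mono ℝ htight))
  obtain ⟨x, hx⟩ := hne
  obtain ⟨p, hpQ, hp⟩ := hslack
  have hpx : slack A (p - (A x, x)) ≠ 0 := by
    rw [slack_sub, sub_self, sub_zero]
    exact (sub_neg.2 hp).ne
  have hslack_ne : slack A ≠ 0 := fun h => hpx (by rw [h, LinearMap.zero_apply])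
  have htop : vectorSpan ℝ (convexHull ℝ Q) = ⊤ := by
    have hle : LinearMap.ker (slack A) ≤ vectorSpan ℝ (convexHull ℝ Q) :=
      hker ▸ vectorSpan_mono ℝ (Set.sep_subset _ _)
    exact (LinearMap.isCoatom_ker_of_surjective (LinearMap.surjective hslack_ne)).2 _
      (SetLike.lt_iff_le_and_exists.2 ⟨hle, _, vsub_mem_vectorSpan ℝ (subset_convexHull ℝ Q hpQ)
        (subset_convexHull ℝ Q hx), hpx⟩)
  refine ⟨fun q hq => ?_, ⟨_, subset_convexHull ℝ Q hx, rfl⟩, ?_⟩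
  · exact convexHull_min hvalid (convex_affine_hypograph A) hq
  · rw [← hF, hker, htop, finrank_top]
    exact Module.Dual.finrank_ker_add_one_of_ne_zero hslack_ne

end Facet

/-! ### Sequential lifting -/

section Lifting

section LiftStage

variable {ι R L : Type*} {D : Finset ι} [LinearOrder L]

/-- The points considered when `σ ℓ` is lifted, for coordinates lifted in the order `σ` from the
reference point `x₀`: those that differ from `x₀` at `σ ℓ` and agree with it at every coordinate
lifted later. -/
def liftStage (x₀ : ι → R) (σ : L ≃ D) (ℓ : L) : Set (ι → R) :=
  {x | x (σ ℓ) ≠ x₀ (σ ℓ) ∧ ∀ τ, ℓ < τ → x (σ τ) = x₀ (σ τ)}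

theorem exists_mem_liftStage [WellFoundedGT L] {x x₀ : ι → R} (σ : L ≃ D)
    (h : ∃ j ∈ D, x j ≠ x₀ j) : ∃ ℓ, x ∈ liftStage x₀ σ ℓ := by
  obtain ⟨j, hj, hne⟩ := h
  obtain ⟨ℓ, hℓ, hmax⟩ := wellFounded_gt.has_min {ℓ | x (σ ℓ) ≠ x₀ (σ ℓ)}
    ⟨σ.symm ⟨j, hj⟩, by simpa using hne⟩
  exact ⟨ℓ, hℓ, fun τ hτ => not_not.1 fun hne => hmax τ hne hτ⟩

theorem sum_eq_sum_lt_add [Fintype L] {M : Type*} [AddCommMonoid M] {f : L → M} {ℓ : L}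
    (hf : ∀ τ, ℓ < τ → f τ = 0) : ∑ τ, f τ = ∑ τ : {τ // τ < ℓ}, f τ + f ℓ := by
  rw [← Finset.sum_subtype (Finset.univ.filter (· < ℓ)) (by simp) f, add_comm,
    ← Finset.sum_insert (by simp)]
  refine (Finset.sum_subset (Finset.subset_univ _) fun τ _ hτ => hf τ ?_).symm
  simp only [Finset.mem_insert, Finset.mem_filter, Finset.mem_univ, true_and, not_or, not_lt] at hτ
  exact hτ.2.lt_of_ne' hτ.1

end LiftStage

variable {E : Type*}

/-- The inequality `w ≤ r(x)` holds at the points of `Q` above `F`, with equality at one of them. -/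
def SupportsOn (Q : Set (ℝ × E)) (F : Set E) (r : E → ℝ) : Prop :=
  (∀ p ∈ Q, p.2 ∈ F → p.1 ≤ r p.2) ∧ (tightPoints Q r ∩ F).Nonempty

theorem supportsOn_of_isGreatest {Q : Set (ℝ × E)} {F : Set E} {r a : E → ℝ} {M : ℝ}
    (hM : IsGreatest ((fun p => p.1 - a p.2) '' {p ∈ Q | p.2 ∈ F}) M)
    (hr : ∀ p ∈ Q, p.2 ∈ F → r p.2 = M + a p.2) : SupportsOn Q F r := by
  constructor
  · intro p hpQ hpF
    rw [hr p hpQ hpF, ← sub_le_iff_le_add]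
    exact hM.2 ⟨p, ⟨hpQ, hpF⟩, rfl⟩
  · obtain ⟨p, ⟨hpQ, hpF⟩, hpM⟩ := hM.1
    have htight : r p.2 = p.1 := by
      rw [hr p hpQ hpF, ← hpM]
      exact sub_add_cancel _ _
    exact ⟨p.2, by rwa [tightPoints, Set.mem_ofPred_eq, htight], hpF⟩

theorem vectorSpan_eq_top_of_liftStage {ι K L : Type*} [Finite ι] [DivisionRing K] [LinearOrder L]
    [WellFoundedLT L] {D : Finset ι} {V : Set (ι → K)} {x₀ : ι → K} (σ : L ≃ D) (hx₀ : x₀ ∈ V)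
    (hneighbour : ∀ i ∉ D, ∃ x ∈ V, x i ≠ x₀ i ∧ ∀ j ≠ i, x j = x₀ j)
    (hstage : ∀ ℓ, (V ∩ liftStage x₀ σ ℓ).Nonempty) : vectorSpan K V = ⊤ := by
  classical
  let rank : ι → WithBot L := fun j => if h : j ∈ D then σ.symm ⟨j, h⟩ else ⊥
  have rank_apply : ∀ τ, rank (σ τ) = τ := fun τ => by simp [rank]
  refine eq_top_of_triangular rank fun i => ?_
  by_cases hi : i ∈ D
  · obtain ⟨ℓ, rfl⟩ : ∃ ℓ, (σ ℓ : ι) = i := ⟨σ.symm ⟨i, hi⟩, by simp⟩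
    obtain ⟨x, hx, hne, hlater⟩ := hstage ℓ
    refine ⟨x - x₀, vsub_mem_vectorSpan K hx hx₀, sub_ne_zero.2 hne, fun j hj hjne => ?_⟩
    by_cases hjD : j ∈ D
    · obtain ⟨τ, rfl⟩ : ∃ τ, (σ τ : ι) = j := ⟨σ.symm ⟨j, hjD⟩, by simp⟩
      have hτ : τ ≠ ℓ := fun h => hj (h ▸ rfl)
      rw [rank_apply, rank_apply, WithBot.coe_lt_coe]
      exact (not_lt.1 fun h => sub_ne_zero.1 hjne (hlater τ h)).lt_of_ne hτ
    · rw [rank_apply, show rank j = ⊥ from dif_neg hjD]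
      exact WithBot.bot_lt_coe ℓ
  · obtain ⟨x, hx, hne, heq⟩ := hneighbour i hi
    exact ⟨x - x₀, vsub_mem_vectorSpan K hx hx₀, sub_ne_zero.2 hne, fun j hj hjne =>
      absurd (heq j hj) (sub_ne_zero.1 hjne)⟩

theorem isFacetDefining_of_supportsOn_liftStage {n : ℕ} {Q : Set (ℝ × (Fin n → ℝ))}
    (hQ : ∀ p ∈ Q, ∀ w ≤ p.1, (w, p.2) ∈ Q) {r : (Fin n → ℝ) → ℝ}
    (hr : ∃ A : (Fin n → ℝ) →ᵃ[ℝ] ℝ, ⇑A = r) {x₀ : Fin n → ℝ} (hx₀ : x₀ ∈ tightPoints Q r)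
    {D : Finset (Fin n)} {L : Type*} [LinearOrder L] [Finite L] (σ : L ≃ D)
    (hbase : ∀ p ∈ Q, (∀ j ∈ D, p.2 j = x₀ j) → p.1 ≤ r p.2)
    (hneighbour : ∀ i ∉ D, ∃ x ∈ tightPoints Q r, x i ≠ x₀ i ∧ ∀ j ≠ i, x j = x₀ j)
    (hstage : ∀ ℓ, SupportsOn Q (liftStage x₀ σ ℓ) r) : IsFacetDefining (convexHull ℝ Q) r := by
  obtain ⟨A, rfl⟩ := hr
  have hvalid : ∀ p ∈ Q, p.1 ≤ A p.2 := fun p hp => by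
    by_cases h : ∀ j ∈ D, p.2 j = x₀ j
    · exact hbase p hp h
    · push Not at h
      obtain ⟨ℓ, hℓ⟩ := exists_mem_liftStage σ h
      exact (hstage ℓ).1 p hp hℓ
  have hslack : ∃ p ∈ Q, p.1 < A p.2 :=
    ⟨(A x₀ - 1, x₀), hQ _ hx₀ _ (sub_one_lt _).le, sub_one_lt _⟩
  exact isFacetDefining_convexHull_of_vectorSpan_eq_top A hvalid hslack ⟨x₀, hx₀⟩
    (vectorSpan_eq_top_of_liftStage σ hx₀ hneighbour fun ℓ => (hstage ℓ).2)

end Lifting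

section LiftedInequalities

variable {n : ℕ} {u₀ : ℝ} {u : Fin n → ℝ} {γ : ℕ} {S : Finset (Fin n)}

theorem mk_mem_X_of_le {p : ℝ × (Fin n → ℝ)} (hp : p ∈ X u₀ u γ) {w : ℝ} (hw : w ≤ p.1) :
    (w, p.2) ∈ X u₀ u γ :=
  ⟨hp.1, hw.trans hp.2⟩

theorem disjoint_singleton_image_Ioi {ι L : Type*} [DecidableEq ι] [LinearOrder L]
    [LocallyFiniteOrderTop L] {D : Finset ι} (σ : L ≃ D) (ℓ : L) :
    Disjoint {(σ ℓ : ι)} ((Finset.Ioi ℓ).image fun τ => (σ τ : ι)) := by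
  simp only [Finset.disjoint_singleton_left, Finset.mem_image, Finset.mem_Ioi, not_exists, not_and,
    SetLike.coe_eq_coe, σ.apply_eq_iff_eq]
  exact fun τ hτ => hτ.ne'

/-! ### Down-lifting -/

section Down

variable (σ : Fin S.card ≃ S)

variable (u₀ u γ) in
theorem exists_affineMap_coe_eq_downLiftedRhs :
    ∃ A : (Fin n → ℝ) →ᵃ[ℝ] ℝ, ⇑A = downLiftedRhs u₀ u γ S σ := by
  let a : (Fin n → ℝ) →ₗ[ℝ] ℝ := ∑ j ∈ Sᶜ, rho u₀ u γ j S • LinearMap.proj j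
    + ∑ ℓ, eta u₀ u γ S σ ℓ • LinearMap.proj (σ ℓ : Fin n)
  refine ⟨a.toAffineMap + AffineMap.const ℝ _ (Phi u₀ u γ S - ∑ ℓ, eta u₀ u γ S σ ℓ),
    funext fun x => ?_⟩
  simp only [a, downLiftedRhs, mul_sub, mul_one, Finset.sum_sub_distrib, LinearMap.coe_toAffineMap,
    LinearMap.add_apply, LinearMap.sum_apply, LinearMap.smul_apply, LinearMap.proj_apply,
    smul_eq_mul, AffineMap.const_apply, AffineMap.coe_add, Pi.add_apply]
  ring

theorem downLiftedRhs_incidence {T : Finset (Fin n)} (hST : S ⊆ T) :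
    downLiftedRhs u₀ u γ S σ (incidence T) = Phi u₀ u γ S + ∑ j ∈ T \ S, rho u₀ u γ j S := by
  have hη : ∑ ℓ, eta u₀ u γ S σ ℓ * (1 - incidence T (σ ℓ)) = 0 :=
    Finset.sum_eq_zero fun ℓ _ => by simp [incidence, hST (σ ℓ).2]
  rw [downLiftedRhs, hη, sub_zero, sum_mul_incidence, Finset.inter_comm,
    Finset.sdiff_eq_inter_compl]

theorem le_downLiftedRhs_of_eq_incidence (hu₀ : 0 < u₀) (hu : ∀ j, 0 ≤ u j)
    {p : ℝ × (Fin n → ℝ)} (hp : p ∈ X u₀ u γ) (hpS : ∀ j ∈ S, p.2 j = incidence S j) :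
    p.1 ≤ downLiftedRhs u₀ u γ S σ p.2 := by
  obtain ⟨T, hT, hle⟩ := (mem_X_iff hu₀ hu).1 hp
  have hST : S ⊆ T := fun j hj => (incidence_eq_incidence_iff.1 (hT ▸ hpS j hj)).2 hj
  calc p.1 ≤ Phi u₀ u γ (S ∪ T \ S) := by rwa [Finset.union_sdiff_of_subset hST]
    _ ≤ Phi u₀ u γ S + ∑ j ∈ T \ S, rho u₀ u γ j S := (isSubmodular_Phi hu₀ hu γ).union_le S _
    _ = downLiftedRhs u₀ u γ S σ p.2 := by rw [hT, downLiftedRhs_incidence σ hST]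

theorem incidence_mem_tightPoints_downLiftedRhs (hu₀ : 0 < u₀) (hu : ∀ j, 0 ≤ u j) :
    incidence S ∈ tightPoints (X u₀ u γ) (downLiftedRhs u₀ u γ S σ) := by
  refine (mem_X_iff hu₀ hu).2 ⟨S, rfl, ?_⟩
  simp [downLiftedRhs_incidence σ subset_rfl]

theorem incidence_insert_mem_tightPoints_downLiftedRhs (hu₀ : 0 < u₀) (hu : ∀ j, 0 ≤ u j)
    {j : Fin n} (hj : j ∉ S) :
    incidence (insert j S) ∈ tightPoints (X u₀ u γ) (downLiftedRhs u₀ u γ S σ) := by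
  refine (mem_X_iff hu₀ hu).2 ⟨insert j S, rfl, ?_⟩
  simp [downLiftedRhs_incidence σ (Finset.subset_insert j S), Finset.insert_sdiff_cancel hj, rho]

variable (u₀ u γ) in
/-- The function `a` whose `w - a(x)` is maximized in the definition of `eta u₀ u γ S σ ℓ`. -/
noncomputable def downLiftingWeight (ℓ : Fin S.card) (x : Fin n → ℝ) : ℝ :=
  ∑ j ∈ Sᶜ, rho u₀ u γ j S * x j + ∑ τ : {τ // τ < ℓ}, eta u₀ u γ S σ τ.1 * x (σ τ.1)

theorem mem_liftStage_incidence_self_iff {ℓ : Fin S.card} {x : Fin n → ℝ}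
    (hx : ∀ j, x j = 0 ∨ x j = 1) :
    x ∈ liftStage (incidence S) σ ℓ ↔ x (σ ℓ) = 0 ∧ ∀ τ, ℓ < τ → x (σ τ) = 1 := by
  have hS : ∀ τ, incidence S (σ τ) = 1 := fun τ => if_pos (σ τ).2
  simp only [liftStage, Set.mem_ofPred_eq, hS]
  exact and_congr_left' ⟨(hx _).resolve_right, fun h => h ▸ zero_ne_one⟩

variable (u₀ u γ) in
theorem XRestr_eq_sep_liftStage_incidence_self (ℓ : Fin S.card) :
    XRestr u₀ u γ {(σ ℓ : Fin n)} ((Finset.Ioi ℓ).image fun τ => (σ τ : Fin n)) =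
      {p ∈ X u₀ u γ | p.2 ∈ liftStage (incidence S) σ ℓ} := by
  ext p
  simp only [XRestr, Set.mem_ofPred_eq, Finset.mem_singleton, forall_eq, Finset.forall_mem_image,
    Finset.mem_Ioi]
  exact and_congr_right fun hp => (mem_liftStage_incidence_self_iff σ hp.1).symm

theorem downLiftedRhs_eq_liftMax_add {ℓ : Fin S.card} {x : Fin n → ℝ} (hℓ : x (σ ℓ) = 0)
    (hlater : ∀ τ, ℓ < τ → x (σ τ) = 1) :
    downLiftedRhs u₀ u γ S σ x =
      liftMax u₀ u γ {(σ ℓ : Fin n)} ((Finset.Ioi ℓ).image fun τ => (σ τ : Fin n))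
        (downLiftingWeight u₀ u γ σ ℓ) + downLiftingWeight u₀ u γ σ ℓ x := by
  have hη : eta u₀ u γ S σ ℓ = Phi u₀ u γ S - ∑ τ : {τ // τ < ℓ}, eta u₀ u γ S σ τ.1
      - liftMax u₀ u γ {(σ ℓ : Fin n)} ((Finset.Ioi ℓ).image fun τ => (σ τ : Fin n))
        (downLiftingWeight u₀ u γ σ ℓ) := eta.eq_1 u₀ u γ S σ ℓ
  have hsum : ∑ τ, eta u₀ u γ S σ τ * (1 - x (σ τ)) =
      ∑ τ : {τ // τ < ℓ}, eta u₀ u γ S σ τ.1 * (1 - x (σ τ.1)) + eta u₀ u γ S σ ℓ := by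
    rw [sum_eq_sum_lt_add (ℓ := ℓ) fun τ hτ => by rw [hlater τ hτ, sub_self, mul_zero], hℓ,
      sub_zero, mul_one]
  rw [downLiftedRhs, hsum, hη, downLiftingWeight]
  simp only [mul_sub, mul_one, Finset.sum_sub_distrib]
  ring

theorem supportsOn_liftStage_downLiftedRhs (ℓ : Fin S.card) :
    SupportsOn (X u₀ u γ) (liftStage (incidence S) σ ℓ) (downLiftedRhs u₀ u γ S σ) := by
  have hM := isGreatest_liftMax u₀ u γ _ _ (disjoint_singleton_image_Ioi σ ℓ)
    (downLiftingWeight u₀ u γ σ ℓ)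
  rw [XRestr_eq_sep_liftStage_incidence_self] at hM
  refine supportsOn_of_isGreatest hM fun p hpX hpℓ => ?_
  obtain ⟨hℓ, hlater⟩ := (mem_liftStage_incidence_self_iff σ hpX.1).1 hpℓ
  exact downLiftedRhs_eq_liftMax_add σ hℓ hlater

theorem isFacetDefining_downLiftedRhs (hu₀ : 0 < u₀) (hu : ∀ j, 0 ≤ u j) :
    IsFacetDefining (convexHull ℝ (X u₀ u γ)) (downLiftedRhs u₀ u γ S σ) := by
  have hneighbour : ∀ i ∉ S, ∃ x ∈ tightPoints (X u₀ u γ) (downLiftedRhs u₀ u γ S σ),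
      x i ≠ incidence S i ∧ ∀ j ≠ i, x j = incidence S j := fun i hi =>
    ⟨_, incidence_insert_mem_tightPoints_downLiftedRhs σ hu₀ hu hi, by simp [incidence, hi],
      fun j hj => by simp [incidence, hj]⟩
  exact isFacetDefining_of_supportsOn_liftStage (fun _ hp _ hw => mk_mem_X_of_le hp hw)
    (exists_affineMap_coe_eq_downLiftedRhs u₀ u γ σ)
    (incidence_mem_tightPoints_downLiftedRhs σ hu₀ hu) σ
    (fun _ => le_downLiftedRhs_of_eq_incidence σ hu₀ hu) hneighbour
    (supportsOn_liftStage_downLiftedRhs σ)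

end Down

/-! ### Up-lifting -/

section Up

variable (σ : Fin Sᶜ.card ≃ (Sᶜ : Finset (Fin n)))

variable (u₀ u γ) in
theorem exists_affineMap_coe_eq_upLiftedRhs :
    ∃ A : (Fin n → ℝ) →ᵃ[ℝ] ℝ, ⇑A = upLiftedRhs u₀ u γ S σ := by
  let a : (Fin n → ℝ) →ₗ[ℝ] ℝ := ∑ j ∈ S, rho u₀ u γ j (S.erase j) • LinearMap.proj j
    + ∑ ℓ, zeta u₀ u γ S σ ℓ • LinearMap.proj (σ ℓ : Fin n)
  refine ⟨a.toAffineMap + AffineMap.const ℝ _ (Phi u₀ u γ S - ∑ j ∈ S, rho u₀ u γ j (S.erase j)),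
    funext fun x => ?_⟩
  simp only [a, upLiftedRhs, mul_sub, mul_one, Finset.sum_sub_distrib, LinearMap.coe_toAffineMap,
    LinearMap.add_apply, LinearMap.sum_apply, LinearMap.smul_apply, LinearMap.proj_apply,
    smul_eq_mul, AffineMap.const_apply, AffineMap.coe_add, Pi.add_apply]
  ring

theorem upLiftedRhs_incidence {T : Finset (Fin n)} (hTS : T ⊆ S) :
    upLiftedRhs u₀ u γ S σ (incidence T)
      = Phi u₀ u γ S - ∑ j ∈ S \ T, rho u₀ u γ j (S.erase j) := by
  have hT : ∀ ℓ, (σ ℓ : Fin n) ∉ T := fun ℓ hℓ => Finset.mem_compl.1 (σ ℓ).2 (hTS hℓ)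
  have hζ : ∑ ℓ, zeta u₀ u γ S σ ℓ * incidence T (σ ℓ) = 0 :=
    Finset.sum_eq_zero fun ℓ _ => by simp [incidence, hT ℓ]
  rw [upLiftedRhs, hζ, add_zero, Finset.sum_sdiff_eq_sub hTS]
  simp only [mul_sub, mul_one, Finset.sum_sub_distrib, sum_mul_incidence,
    Finset.inter_eq_right.2 hTS]

theorem le_upLiftedRhs_of_eq_incidence (hu₀ : 0 < u₀) (hu : ∀ j, 0 ≤ u j)
    {p : ℝ × (Fin n → ℝ)} (hp : p ∈ X u₀ u γ) (hpS : ∀ j ∈ Sᶜ, p.2 j = incidence S j) :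
    p.1 ≤ upLiftedRhs u₀ u γ S σ p.2 := by
  obtain ⟨T, hT, hle⟩ := (mem_X_iff hu₀ hu).1 hp
  have hTS : T ⊆ S := fun j hjT => by
    by_contra hjS
    exact hjS ((incidence_eq_incidence_iff.1 (hT ▸ hpS j (Finset.mem_compl.2 hjS))).1 hjT)
  have hrho : ∑ j ∈ S \ T, rho u₀ u γ j (S.erase j)
      = ∑ j ∈ S \ T, (Phi u₀ u γ S - Phi u₀ u γ (S.erase j)) := Finset.sum_congr rfl fun j hj => by
    rw [rho, Finset.insert_erase (Finset.sdiff_subset hj)]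
  calc p.1 ≤ Phi u₀ u γ (S \ (S \ T)) := by rwa [Finset.sdiff_sdiff_eq_self hTS]
    _ ≤ Phi u₀ u γ S - ∑ j ∈ S \ T, rho u₀ u γ j (S.erase j) :=
        hrho ▸ (isSubmodular_Phi hu₀ hu γ).sdiff_le Finset.sdiff_subset
    _ = upLiftedRhs u₀ u γ S σ p.2 := by rw [hT, upLiftedRhs_incidence σ hTS]

theorem incidence_mem_tightPoints_upLiftedRhs (hu₀ : 0 < u₀) (hu : ∀ j, 0 ≤ u j) :
    incidence S ∈ tightPoints (X u₀ u γ) (upLiftedRhs u₀ u γ S σ) := by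
  refine (mem_X_iff hu₀ hu).2 ⟨S, rfl, ?_⟩
  simp [upLiftedRhs_incidence σ subset_rfl]

theorem incidence_erase_mem_tightPoints_upLiftedRhs (hu₀ : 0 < u₀) (hu : ∀ j, 0 ≤ u j)
    {j : Fin n} (hj : j ∈ S) :
    incidence (S.erase j) ∈ tightPoints (X u₀ u γ) (upLiftedRhs u₀ u γ S σ) := by
  refine (mem_X_iff hu₀ hu).2 ⟨S.erase j, rfl, ?_⟩
  simp [upLiftedRhs_incidence σ (S.erase_subset j), Finset.sdiff_erase_self hj, rho,
    Finset.insert_erase hj]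

variable (u₀ u γ) in
/-- The function `a` whose `w - a(x)` is maximized in the definition of `zeta u₀ u γ S σ ℓ`. -/
noncomputable def upLiftingWeight (ℓ : Fin Sᶜ.card) (x : Fin n → ℝ) : ℝ :=
  ∑ j ∈ S, rho u₀ u γ j (S.erase j) * x j
    + ∑ τ : {τ // τ < ℓ}, zeta u₀ u γ S σ τ.1 * x (σ τ.1)

theorem mem_liftStage_incidence_compl_iff {ℓ : Fin Sᶜ.card} {x : Fin n → ℝ}
    (hx : ∀ j, x j = 0 ∨ x j = 1) :
    x ∈ liftStage (incidence S) σ ℓ ↔ x (σ ℓ) = 1 ∧ ∀ τ, ℓ < τ → x (σ τ) = 0 := by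
  have hS : ∀ τ, incidence S (σ τ) = 0 := fun τ => if_neg (Finset.mem_compl.1 (σ τ).2)
  simp only [liftStage, Set.mem_ofPred_eq, hS]
  exact and_congr_left' ⟨(hx _).resolve_left, fun h => h ▸ one_ne_zero⟩

variable (u₀ u γ) in
theorem XRestr_eq_sep_liftStage_incidence_compl (ℓ : Fin Sᶜ.card) :
    XRestr u₀ u γ ((Finset.Ioi ℓ).image fun τ => (σ τ : Fin n)) {(σ ℓ : Fin n)} =
      {p ∈ X u₀ u γ | p.2 ∈ liftStage (incidence S) σ ℓ} := by
  ext p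
  simp only [XRestr, Set.mem_ofPred_eq, Finset.mem_singleton, forall_eq, Finset.forall_mem_image,
    Finset.mem_Ioi]
  exact and_congr_right fun hp =>
    and_comm.trans (mem_liftStage_incidence_compl_iff σ hp.1).symm

theorem upLiftedRhs_eq_liftMax_add {ℓ : Fin Sᶜ.card} {x : Fin n → ℝ} (hℓ : x (σ ℓ) = 1)
    (hlater : ∀ τ, ℓ < τ → x (σ τ) = 0) :
    upLiftedRhs u₀ u γ S σ x =
      liftMax u₀ u γ ((Finset.Ioi ℓ).image fun τ => (σ τ : Fin n)) {(σ ℓ : Fin n)}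
        (upLiftingWeight u₀ u γ σ ℓ) + upLiftingWeight u₀ u γ σ ℓ x := by
  have hζ : zeta u₀ u γ S σ ℓ = -Phi u₀ u γ S + ∑ j ∈ S, rho u₀ u γ j (S.erase j)
      + liftMax u₀ u γ ((Finset.Ioi ℓ).image fun τ => (σ τ : Fin n)) {(σ ℓ : Fin n)}
        (upLiftingWeight u₀ u γ σ ℓ) := zeta.eq_1 u₀ u γ S σ ℓ
  have hsum : ∑ τ, zeta u₀ u γ S σ τ * x (σ τ) =
      ∑ τ : {τ // τ < ℓ}, zeta u₀ u γ S σ τ.1 * x (σ τ.1) + zeta u₀ u γ S σ ℓ := by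
    rw [sum_eq_sum_lt_add (ℓ := ℓ) fun τ hτ => by rw [hlater τ hτ, mul_zero], hℓ, mul_one]
  rw [upLiftedRhs, hsum, hζ, upLiftingWeight]
  simp only [mul_sub, mul_one, Finset.sum_sub_distrib]
  ring

theorem supportsOn_liftStage_upLiftedRhs (ℓ : Fin Sᶜ.card) :
    SupportsOn (X u₀ u γ) (liftStage (incidence S) σ ℓ) (upLiftedRhs u₀ u γ S σ) := by
  have hM := isGreatest_liftMax u₀ u γ _ _ (disjoint_singleton_image_Ioi σ ℓ).symm
    (upLiftingWeight u₀ u γ σ ℓ)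
  rw [XRestr_eq_sep_liftStage_incidence_compl] at hM
  refine supportsOn_of_isGreatest hM fun p hpX hpℓ => ?_
  obtain ⟨hℓ, hlater⟩ := (mem_liftStage_incidence_compl_iff σ hpX.1).1 hpℓ
  exact upLiftedRhs_eq_liftMax_add σ hℓ hlater

theorem isFacetDefining_upLiftedRhs (hu₀ : 0 < u₀) (hu : ∀ j, 0 ≤ u j) :
    IsFacetDefining (convexHull ℝ (X u₀ u γ)) (upLiftedRhs u₀ u γ S σ) := by
  have hneighbour : ∀ i ∉ Sᶜ, ∃ x ∈ tightPoints (X u₀ u γ) (upLiftedRhs u₀ u γ S σ),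
      x i ≠ incidence S i ∧ ∀ j ≠ i, x j = incidence S j := fun i hi => by
    rw [Finset.mem_compl, not_not] at hi
    exact ⟨_, incidence_erase_mem_tightPoints_upLiftedRhs σ hu₀ hu hi, by simp [incidence, hi],
      fun j hj => by simp [incidence, hj]⟩
  exact isFacetDefining_of_supportsOn_liftStage (fun _ hp _ hw => mk_mem_X_of_le hp hw)
    (exists_affineMap_coe_eq_upLiftedRhs u₀ u γ σ)
    (incidence_mem_tightPoints_upLiftedRhs σ hu₀ hu) σ
    (fun _ => le_upLiftedRhs_of_eq_incidence σ hu₀ hu) hneighbour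
    (supportsOn_liftStage_upLiftedRhs σ)

end Up

end LiftedInequalities

end LiftedSubmodular

theorem proposition3_general {n : ℕ} (u₀ : ℝ) (hu₀ : 0 < u₀) (u : Fin n → ℝ) (hu : ∀ j, 0 ≤ u j)
    (γ : ℕ) (S : Finset (Fin n)) :
    (∀ σ : Fin S.card ≃ S,
      LiftedSubmodular.IsFacetDefining (convexHull ℝ (LiftedSubmodular.X u₀ u γ))
        (LiftedSubmodular.downLiftedRhs u₀ u γ S σ)) ∧
    (∀ σ : Fin Sᶜ.card ≃ (Sᶜ : Finset (Fin n)),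
      LiftedSubmodular.IsFacetDefining (convexHull ℝ (LiftedSubmodular.X u₀ u γ))
        (LiftedSubmodular.upLiftedRhs u₀ u γ S σ)) :=
  ⟨fun σ => LiftedSubmodular.isFacetDefining_downLiftedRhs σ hu₀ hu,
    fun σ => LiftedSubmodular.isFacetDefining_upLiftedRhs σ hu₀ hu⟩

theorem proposition3 {n : ℕ} (u₀ : ℝ) (hu₀ : 0 < u₀) (u : Fin n → ℝ) (hu : ∀ j, 0 ≤ u j)
    (hanti : Antitone u) (γ : ℕ) (hγ : 1 ≤ γ) (S : Finset (Fin n)) :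
    (∀ σ : Fin S.card ≃ S,
      LiftedSubmodular.IsFacetDefining (convexHull ℝ (LiftedSubmodular.X u₀ u γ))
        (LiftedSubmodular.downLiftedRhs u₀ u γ S σ)) ∧
    (∀ σ : Fin Sᶜ.card ≃ (Sᶜ : Finset (Fin n)),
      LiftedSubmodular.IsFacetDefining (convexHull ℝ (LiftedSubmodular.X u₀ u γ))
        (LiftedSubmodular.upLiftedRhs u₀ u γ S σ)) :=
  proposition3_general u₀ hu₀ u hu γ S
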